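/- **Setting.** Let $S$ and $A$ be finite sets, let $A(s)\subseteq A$ be nonempty for every $s\in S$, and let $p(s'\mid s,a)$ ($s,s'\in S$, $a\in A(s)$) be transition probabilities of a Markov decision process with costs $c_M(s,a)\ge 0$. Let $\Omega_p\subset\mathbb{R}$ be a finite set of transmission power levels with real costs $c_p(s,p)$ (for example $c_p(p)$), and let $\theta(s,p)\in[0,1)$, nonincreasing in $p$, be the packet drop-out probability in state $s$ at power $p$. Let $\lambda>0$, let $\varrho>0$ and $\lambda_1<\lambda_0$ be real constants, and set $\bar\eta=\frac{1-\lambda_1\varrho}{\varrho(\lambda_0-\lambda_1)}$. A policy $\mu=(\mu^m,\mu^p)$ chooses at each time $k\ge 0$, given the history $(s_0,a_0,p_0,\dots,s_{k-1},a_{k-1},p_{k-1},s_k)$, an action $a_k\in A(s_k)$ and a power level $p_k\in\Omega_p$ independently from probability distributions $\mu^m_k(\cdot)$ and $\mu^p_k(\cdot)$ that may depend on the history; it is stationary if these depend only on the current state, $\mu^m_k(a)=\mu^m_\infty(a\mid s_k)$ and $\mu^p_k(p)=\mu^p_\infty(p\mid s_k)$ for all $k$. Fix $s_0\in S$. The co-design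 problem with the ASE (asymptotic safety in expectation) safety constraint is to minimize $$J(s_0,\mu)=\limsup_{T\to\infty}\frac1T\,\mathbb{E}^{\mu}_{s_0}\Big[\sum_{k=0}^{T}c_M(s_k,a_k)+\lambda c_p(s_k,p_k)\Big]$$ over all history-dependent policies $\mu$ subject to $$\limsup_{T\to\infty}\frac1T\sum_{k=0}^{T}\mathbb{E}^{\mu}_{s_0}[\theta(s_k,p_k)]<\bar\eta .$$ For a stationary policy under the assumption below, the constraint reads $\sum_{s,p}\theta(s,p)\,\bar\pi(s,p)<\bar\eta$, where $\bar\pi$ is the stationary distribution of the Markov chain $(s_k,p_k)$. **Assumption 2 (unichain).** For a given integer $n\ge1$ and every $1\le k\le n$, the product $P_1\cdots P_k$ of the transition matrices on $S$ induced by any $k$ randomized control decision rules $s\mapsto\mu^m(\cdot\mid s)$ is aperiodic and has a single ergodic class. **Linear program.** Over occupation measures $X_1(s,a)\ge0$ ($s\in S$, $a\in A(s)$) and $X_2(s,p)\ge0$ ($s\in S$, $p\in\Omega_p$), minimize $$\sum_{s}\sum_{a\in A(s)}X_1(s,a)c_M(s,a)+\lambda\sum_{s,p}X_2(s,p)c_p(s,p)$$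 subject to $$\sum_{a\in A(s')}X_1(s',a)-\sum_{s}\sum_{a\in A(s)}p(s'\mid s,a)X_1(s,a)=0\quad\forall s'\in S,$$ $$\sum_{s}\sum_{a\in A(s)}X_1(s,a)=1,\qquad \sum_{s,p}X_2(s,p)=1,$$ $$\sum_{a\in A(s)}X_1(s,a)=\sum_{p\in\Omega_p}X_2(s,p)\quad\forall s\in S,\qquad \sum_{s,p}\theta(s,p)X_2(s,p)<\bar\eta .$$ **Theorem.** Suppose that Assumption 2 holds. 1. Let $(X_1^*,X_2^*)$ be an optimal solution of the linear program. Then there are stationary policies $\mu_\infty=(\mu^m_\infty,\mu^p_\infty)$ with $$\mu^m_\infty(a\mid s)=\frac{X_1^*(s,a)}{\sum_{a'\in A(s)}X_1^*(s,a')},\qquad \mu^p_\infty(p\mid s)=\frac{X_2^*(s,p)}{\sum_{p'\in\Omega_p}X_2^*(s,p')}$$ at every $s$ where the denominators are nonzero (the distributions being arbitrary at all other $s$), and every such $\mu_\infty$ is an optimal solution of the co-design problem among all history-dependent policies. For it the limit defining $J(s_0,\mu_\infty)$ exists and equals the optimal value of the linear program, and the chain $(s_k,p_k)$ has a unique stationary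 distribution $\bar\pi$, which equals $X_2^*$ and satisfies $\sum_{s,p}\theta(s,p)\bar\pi(s,p)<\bar\eta$. 2. Conversely, every stationary policy that is optimal for the co-design problem arises in this way from an optimal solution of the linear program. -/

import Mathlib

open scoped Matrix
open Filter Topology

noncomputable section

/-! ### The system data -/

/-- A finite Markov decision process: `act s` is the set `A(s)` of actions available at `s`,
`p s a s'` is the probability `p(s' | s, a)` of moving from `s` to `s'` under `a`,
and `cost s a` is the cost `c_M(s, a)`. -/
structure MDP (S A : Type*) [Fintype S] where
  act : S → Finset A
  act_nonempty : ∀ s, (act s).Nonempty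
  p : S → A → S → ℝ
  p_nonneg : ∀ s, ∀ a ∈ act s, ∀ s', 0 ≤ p s a s'
  p_sum : ∀ s, ∀ a ∈ act s, ∑ s', p s a s' = 1
  cost : S → A → ℝ
  cost_nonneg : ∀ s, ∀ a ∈ act s, 0 ≤ cost s a

/-- The drop-out probabilities `θ(s, p)` of a state-dependent dropout channel with finite set
`Ωp` of transmission power levels. -/
structure SDDC (S : Type*) (Ωp : Finset ℝ) where
  θ : S → Ωp → ℝ
  θ_nonneg : ∀ s p, 0 ≤ θ s p
  θ_lt_one : ∀ s p, θ s p < 1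
  θ_anti : ∀ s, Antitone (θ s)

/-- The data of the co-design problem. `powerCost s p` is the power cost (the case of a cost
`c_p(p)` of the power level alone is included), `lam > 0` is the weight of the power cost in
the joint cost, and `lam0`, `lam1`, `rho` are the Lyapunov constants in the safety threshold. -/
structure CoDesign (S A : Type*) [Fintype S] (Ωp : Finset ℝ) where
  mdp : MDP S A
  channel : SDDC S Ωp
  powerCost : S → Ωp → ℝ
  lam : ℝ
  lam_pos : 0 < lam
  lam0 : ℝ
  lam1 : ℝ
  rho : ℝ
  rho_pos : 0 < rho
  lam1_lt_lam0 : lam1 < lam0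

/-- The right-hand side of the safety constraint. -/
def CoDesign.threshold {S A : Type*} [Fintype S] {Ωp : Finset ℝ} (D : CoDesign S A Ωp) : ℝ :=
  (1 - D.lam1 * D.rho) / (D.rho * (D.lam0 - D.lam1))

/-! ### Decision rules and policies -/

/-- A randomized control decision rule `s ↦ μ^m(· | s)`, a probability distribution on `A(s)`
for each state `s`. -/
structure ControlRule {S A : Type*} [Fintype S] (M : MDP S A) where
  toFun : S → A → ℝ
  nonneg : ∀ s a, 0 ≤ toFun s a
  eq_zero : ∀ s a, a ∉ M.act s → toFun s a = 0
  sum_eq_one : ∀ s, ∑ a ∈ M.act s, toFun s a = 1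

/-- A randomized power decision rule `s ↦ μ^p(· | s)`, a probability distribution on `Ωp` for
each state `s`. -/
structure PowerRule (S : Type*) (Ωp : Finset ℝ) where
  toFun : S → Ωp → ℝ
  nonneg : ∀ s p, 0 ≤ toFun s p
  sum_eq_one : ∀ s, ∑ p, toFun s p = 1

/-- A joint randomized history-dependent policy `(μ^m, μ^p)`. The past
`(s₀, a₀, p₀), …, (s_{k-1}, a_{k-1}, p_{k-1})` is a list, most recent entry first; it determines
the control rule and the power rule that are applied to the current state `s_k`
at time `k` (the length of the list). -/
structure Policy {S A : Type*} [Fintype S] (M : MDP S A) (Ωp : Finset ℝ) where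
  control : List (S × A × Ωp) → ControlRule M
  power : List (S × A × Ωp) → PowerRule S Ωp

/-- The stationary policy that applies the same two decision rules at all times. -/
def Policy.stationary {S A : Type*} [Fintype S] {M : MDP S A} {Ωp : Finset ℝ}
    (m : ControlRule M) (w : PowerRule S Ωp) : Policy M Ωp where
  control := fun _ => m
  power := fun _ => w

/-! ### The law of the controlled process -/

/-- The probability, from the initial state `s0`, that the past is `h` (most recent entry first)
and that the current state is `s`. -/
def Policy.pathProb {S A : Type*} [Fintype S] [DecidableEq S] {M : MDP S A} {Ωp : Finset ℝ}
    (μ : Policy M Ωp) (s0 : S) : List (S × A × Ωp) → S → ℝ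
  | [], s => if s = s0 then 1 else 0
  | (s', a, p) :: h, s =>
      μ.pathProb s0 h s' * (μ.control h).toFun s' a * (μ.power h).toFun s' p * M.p s' a s

/-- The probability `P{s_k = s, a_k = a, p_k = p}` from the initial state `s0`; given the history
up to time `k`, the action and the power level are drawn independently from `μ^m_k`, `μ^p_k`. -/
def Policy.prob {S A : Type*} [Fintype S] [DecidableEq S] [Fintype A] {M : MDP S A}
    {Ωp : Finset ℝ} (μ : Policy M Ωp) (s0 : S) (k : ℕ) (s : S) (a : A) (p : Ωp) : ℝ :=
  ∑ h : Fin k → S × A × Ωp, μ.pathProb s0 (List.ofFn h) s *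
    (μ.control (List.ofFn h)).toFun s a * (μ.power (List.ofFn h)).toFun s p

/-- The time average `(1/T) ∑_{k=0}^{T} E[f(s_k, a_k, p_k)]` from the initial state `s0`. -/
def Policy.timeAvg {S A : Type*} [Fintype S] [DecidableEq S] [Fintype A] {M : MDP S A}
    {Ωp : Finset ℝ} (μ : Policy M Ωp) (s0 : S) (f : S → A → Ωp → ℝ) (T : ℕ) : ℝ :=
  (1 / (T : ℝ)) * ∑ k ∈ Finset.range (T + 1), ∑ s, ∑ a ∈ M.act s, ∑ p, μ.prob s0 k s a p * f s a p

/-! ### Markov chains -/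

/-- The transition matrix of the MDP under a control rule; rows are indexed by the present
state. -/
def ControlRule.transition {S A : Type*} [Fintype S] {M : MDP S A} (m : ControlRule M) :
    Matrix S S ℝ :=
  Matrix.of fun s s' => ∑ a ∈ M.act s, M.p s a s' * m.toFun s a

/-- `C` is an ergodic class of the chain with transition matrix `Q`: it is nonempty, and from
each of its states exactly the states of `C` can be reached. -/
def IsErgodicClass {I : Type*} [Fintype I] [DecidableEq I] (Q : Matrix I I ℝ) (C : Set I) : Prop :=
  C.Nonempty ∧ ∀ i ∈ C, ∀ j, (∃ m : ℕ, 0 < (Q ^ m) i j) ↔ j ∈ C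

/-- The chain has a single ergodic class. -/
def HasSingleErgodicClass {I : Type*} [Fintype I] [DecidableEq I] (Q : Matrix I I ℝ) : Prop :=
  ∃! C : Set I, IsErgodicClass Q C

/-- The chain is aperiodic: at every state of an ergodic class, the return times have no common
divisor but `1`. -/
def IsAperiodicChain {I : Type*} [Fintype I] [DecidableEq I] (Q : Matrix I I ℝ) : Prop :=
  ∀ C : Set I, IsErgodicClass Q C → ∀ i ∈ C,
    ∀ d : ℕ, (∀ m : ℕ, 1 ≤ m → 0 < (Q ^ m) i i → d ∣ m) → d = 1

/-- The unichain assumption at horizon `n`: for `1 ≤ k ≤ n`, the product of the transition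
matrices of any `k` control rules is aperiodic and has a single ergodic class. -/
def MDP.IsUnichain {S A : Type*} [Fintype S] [DecidableEq S] (M : MDP S A) (n : ℕ) : Prop :=
  ∀ k : ℕ, 1 ≤ k → k ≤ n → ∀ m : Fin k → ControlRule M,
    IsAperiodicChain (List.ofFn fun i => (m i).transition).prod ∧
    HasSingleErgodicClass (List.ofFn fun i => (m i).transition).prod

/-- The transition matrix of the joint process `(s_k, p_k)` under a stationary policy. -/
def jointTransition {S A : Type*} [Fintype S] {M : MDP S A} {Ωp : Finset ℝ}
    (m : ControlRule M) (w : PowerRule S Ωp) : Matrix (S × Ωp) (S × Ωp) ℝ :=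
  Matrix.of fun x y => w.toFun y.1 y.2 * ∑ a ∈ M.act x.1, M.p x.1 a y.1 * m.toFun x.1 a

/-- `π` is a stationary probability distribution of the chain with transition matrix `Q`. -/
def IsStationaryDistribution {I : Type*} [Fintype I] (Q : Matrix I I ℝ) (π : I → ℝ) : Prop :=
  (∀ i, 0 ≤ π i) ∧ ∑ i, π i = 1 ∧ π ᵥ* Q = π

/-! ### The co-design problem -/

namespace CoDesign

/-- The joint running cost `c_M(s, a) + lam * c_p(s, p)`. -/
def runningCost {S A : Type*} [Fintype S] {Ωp : Finset ℝ} (D : CoDesign S A Ωp)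
    (s : S) (a : A) (p : Ωp) : ℝ :=
  D.mdp.cost s a + D.lam * D.powerCost s p

/-- The long-run average cost `J(s0, μ)`; the limit superior, since for a general
history-dependent policy the limit need not exist. -/
def J {S A : Type*} [Fintype S] [DecidableEq S] [Fintype A] {Ωp : Finset ℝ}
    (D : CoDesign S A Ωp) (s0 : S) (μ : Policy D.mdp Ωp) : ℝ :=
  limsup (μ.timeAvg s0 D.runningCost) atTop

/-- The safety constraint for a history-dependent policy: the long-run average (limit superior)
of the drop-out probability is below the threshold. -/
def Safe {S A : Type*} [Fintype S] [DecidableEq S] [Fintype A] {Ωp : Finset ℝ}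
    (D : CoDesign S A Ωp) (s0 : S) (μ : Policy D.mdp Ωp) : Prop :=
  limsup (μ.timeAvg s0 fun s _ p => D.channel.θ s p) atTop < D.threshold

/-- `μ` solves the co-design problem: it is safe and minimizes the average cost among all safe
history-dependent policies. -/
def IsOptimalPolicy {S A : Type*} [Fintype S] [DecidableEq S] [Fintype A] {Ωp : Finset ℝ}
    (D : CoDesign S A Ωp) (s0 : S) (μ : Policy D.mdp Ωp) : Prop :=
  D.Safe s0 μ ∧ ∀ ν : Policy D.mdp Ωp, D.Safe s0 ν → D.J s0 μ ≤ D.J s0 ν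

/-! ### The linear program -/

/-- The feasible set of the linear program in `X₁(s, a)` (`a ∈ A(s)`) and `X₂(s, p)`. -/
structure LPFeasible {S A : Type*} [Fintype S] {Ωp : Finset ℝ} (D : CoDesign S A Ωp)
    (X₁ : S → A → ℝ) (X₂ : S → Ωp → ℝ) : Prop where
  nonneg₁ : ∀ s, ∀ a ∈ D.mdp.act s, 0 ≤ X₁ s a
  nonneg₂ : ∀ s p, 0 ≤ X₂ s p
  balance : ∀ s', ∑ a ∈ D.mdp.act s', X₁ s' a
    - ∑ s, ∑ a ∈ D.mdp.act s, D.mdp.p s a s' * X₁ s a = 0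
  sum₁ : ∑ s, ∑ a ∈ D.mdp.act s, X₁ s a = 1
  sum₂ : ∑ s, ∑ p, X₂ s p = 1
  marginal : ∀ s, ∑ a ∈ D.mdp.act s, X₁ s a = ∑ p, X₂ s p
  safety : ∑ s, ∑ p, D.channel.θ s p * X₂ s p < D.threshold

/-- The objective of the linear program. -/
def lpValue {S A : Type*} [Fintype S] {Ωp : Finset ℝ} (D : CoDesign S A Ωp)
    (X₁ : S → A → ℝ) (X₂ : S → Ωp → ℝ) : ℝ :=
  ∑ s, ∑ a ∈ D.mdp.act s, X₁ s a * D.mdp.cost s a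
    + D.lam * ∑ s, ∑ p, X₂ s p * D.powerCost s p

/-- `(X₁, X₂)` is an optimal solution of the linear program. -/
def IsLPOptimal {S A : Type*} [Fintype S] {Ωp : Finset ℝ} (D : CoDesign S A Ωp)
    (X₁ : S → A → ℝ) (X₂ : S → Ωp → ℝ) : Prop :=
  D.LPFeasible X₁ X₂ ∧
    ∀ (Y₁ : S → A → ℝ) (Y₂ : S → Ωp → ℝ), D.LPFeasible Y₁ Y₂ → D.lpValue X₁ X₂ ≤ D.lpValue Y₁ Y₂

/-- The rules `m` and `w` are the normalizations of `X₁` and `X₂`; no condition is imposed at a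
state where the denominator vanishes. -/
def IsNormalization {S A : Type*} [Fintype S] {Ωp : Finset ℝ} (D : CoDesign S A Ωp)
    (X₁ : S → A → ℝ) (X₂ : S → Ωp → ℝ) (m : ControlRule D.mdp) (w : PowerRule S Ωp) : Prop :=
  (∀ s, ∑ a' ∈ D.mdp.act s, X₁ s a' ≠ 0 →
    ∀ a ∈ D.mdp.act s, m.toFun s a = X₁ s a / ∑ a' ∈ D.mdp.act s, X₁ s a') ∧
  (∀ s, ∑ p', X₂ s p' ≠ 0 → ∀ p, w.toFun s p = X₂ s p / ∑ p', X₂ s p')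

end CoDesign

end

/-! ### Finite Markov chains -/

section MarkovChain

variable {I : Type*} [Fintype I] [DecidableEq I]

/-! Time-averaged occupation measures of triples (state, action, power level) turn the control
problem into the linear program. For any policy they lie in a compact box and satisfy the flow
balance up to a telescoped boundary term of order 1/T, so each limit along an ultrafilter is exactly
balanced. Cost and drop-out are linear in the measure and split into terms in (s, a) and (s, p), so
only its two marginals matter. Limits of the averages are at most their limit superior; hence for a
safe policy the marginals are feasible, strict constraint included, with value at most `J`
(`CoDesign.exists_lpFeasible_le_J`).

Conversely, a feasible point normalizes to a stationary policy whose state chain leaves the state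
marginal invariant. The unichain assumption makes the invariant distribution unique
(`HasSingleErgodicClass.stationary_unique`), so all cluster points of the occupation measures
coincide and the averages converge, from any initial state, to the objective and the constraint
value of the program (`CoDesign.LPFeasible.stationary_safe`). Feasible points and safe stationary
policies thus realize the same values, and both directions of the theorem follow by comparison. -/

theorem matrix_pow_nonneg {Q : Matrix I I ℝ} (hQ : ∀ i j, 0 ≤ Q i j) (m : ℕ) :
    ∀ i j, 0 ≤ (Q ^ m) i j := by
  induction m with
  | zero =>
    intro i j
    rw [pow_zero, Matrix.one_apply]
    split_ifs <;> norm_num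
  | succ m ih =>
    intro i j
    rw [pow_succ, Matrix.mul_apply]
    exact Finset.sum_nonneg fun k _ => mul_nonneg (ih i k) (hQ k j)

theorem matrix_pow_add_pos {Q : Matrix I I ℝ} (hQ : ∀ i j, 0 ≤ Q i j) {m n : ℕ} {i j k : I}
    (h₁ : 0 < (Q ^ m) i j) (h₂ : 0 < (Q ^ n) j k) : 0 < (Q ^ (m + n)) i k := by
  rw [pow_add, Matrix.mul_apply]
  exact Finset.sum_pos' (fun l _ => mul_nonneg (matrix_pow_nonneg hQ m i l)
    (matrix_pow_nonneg hQ n l k)) ⟨j, Finset.mem_univ j, mul_pos h₁ h₂⟩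

/-- Every nonempty closed set of states of a finite chain contains an ergodic class. -/
theorem exists_isErgodicClass_subset {Q : Matrix I I ℝ} (hQ : ∀ i j, 0 ≤ Q i j) {C : Set I}
    (hne : C.Nonempty) (hcl : ∀ i ∈ C, ∀ j, ∀ m : ℕ, 0 < (Q ^ m) i j → j ∈ C) :
    ∃ E ⊆ C, IsErgodicClass Q E := by
  -- Take a state with the fewest reachable states. Anything reached from it reaches a subset of
  -- these, and no fewer, hence exactly the same set.
  obtain ⟨i, hi, hmin⟩ := Set.exists_min_image C
    (fun i => {j | ∃ m : ℕ, 0 < (Q ^ m) i j}.ncard) (Set.toFinite C) hne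
  refine ⟨{j | ∃ m : ℕ, 0 < (Q ^ m) i j}, fun j ⟨m, hm⟩ => hcl i hi j m hm,
    ⟨i, 0, by simp⟩, ?_⟩
  rintro j ⟨m, hm⟩ k
  have hsub : {k | ∃ n : ℕ, 0 < (Q ^ n) j k} ⊆ {k | ∃ n : ℕ, 0 < (Q ^ n) i k} :=
    fun k ⟨n, hn⟩ => ⟨m + n, matrix_pow_add_pos hQ hm hn⟩
  have heq := Set.eq_of_subset_of_ncard_le hsub (hmin j (hcl i hi j m hm)) (Set.toFinite _)
  exact Set.ext_iff.mp heq k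

theorem vecMul_pow_eq_of_vecMul_eq {Q : Matrix I I ℝ} {v : I → ℝ} (hv : v ᵥ* Q = v) (m : ℕ) :
    v ᵥ* (Q ^ m) = v := by
  induction m with
  | zero => simp
  | succ m ih => rw [pow_succ, ← Matrix.vecMul_vecMul, ih, hv]

/-- The support of a nonnegative invariant vector contains an ergodic class. -/
theorem exists_isErgodicClass_subset_support {Q : Matrix I I ℝ} (hQ : ∀ i j, 0 ≤ Q i j)
    {v : I → ℝ} (hv0 : ∀ i, 0 ≤ v i) (hv : v ᵥ* Q = v) (hne : ∃ i, v i ≠ 0) :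
    ∃ E : Set I, (∀ i ∈ E, 0 < v i) ∧ IsErgodicClass Q E := by
  obtain ⟨i, hi⟩ := hne
  refine exists_isErgodicClass_subset hQ (C := {i | 0 < v i})
    ⟨i, lt_of_le_of_ne (hv0 i) (Ne.symm hi)⟩ ?_
  intro i (hi : 0 < v i) j m hm
  have h := congrFun (vecMul_pow_eq_of_vecMul_eq hv m) j
  change 0 < v j
  rw [← h, Matrix.vecMul, dotProduct]
  exact Finset.sum_pos' (fun k _ => mul_nonneg (hv0 k) (matrix_pow_nonneg hQ m k j))
    ⟨i, Finset.mem_univ i, mul_pos hi hm⟩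

omit [DecidableEq I] in
/-- The absolute value of an invariant vector of a stochastic matrix is invariant. -/
theorem abs_vecMul_eq {Q : Matrix I I ℝ} (hQ : ∀ i j, 0 ≤ Q i j) (hQ1 : ∀ i, ∑ j, Q i j = 1)
    {d : I → ℝ} (hd : d ᵥ* Q = d) : (fun i => |d i|) ᵥ* Q = fun i => |d i| := by
  have hle : ∀ j ∈ Finset.univ, |d j| ≤ ((fun i => |d i|) ᵥ* Q) j := by
    intro j _
    calc |d j| = |∑ i, d i * Q i j| := by
          conv_lhs => rw [← hd]
          rfl
      _ ≤ ∑ i, |d i * Q i j| := Finset.abs_sum_le_sum_abs _ _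
      _ = ∑ i, |d i| * Q i j :=
          Finset.sum_congr rfl fun i _ => by rw [abs_mul, abs_of_nonneg (hQ i j)]
  -- Rows sum to one, so both sides of the pointwise triangle inequality have the same total; every
  -- inequality is then an equality.
  have hsum : ∑ j, |d j| = ∑ j, ((fun i => |d i|) ᵥ* Q) j := by
    simp only [Matrix.vecMul, dotProduct]
    rw [Finset.sum_comm]
    exact Finset.sum_congr rfl fun i _ => by rw [← Finset.mul_sum, hQ1, mul_one]
  funext j
  exact ((Finset.sum_eq_sum_iff_of_le hle).mp hsum j (Finset.mem_univ j)).symm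

/-- A finite chain with a single ergodic class has at most one stationary distribution. -/
theorem HasSingleErgodicClass.stationary_unique {Q : Matrix I I ℝ}
    (hC : HasSingleErgodicClass Q) (hQ : ∀ i j, 0 ≤ Q i j) (hQ1 : ∀ i, ∑ j, Q i j = 1)
    {π π' : I → ℝ} (h : IsStationaryDistribution Q π) (h' : IsStationaryDistribution Q π') :
    π = π' := by
  set d : I → ℝ := π - π' with hd
  have hdQ : d ᵥ* Q = d := by rw [hd, Matrix.sub_vecMul, h.2.2, h'.2.2]
  have habs := abs_vecMul_eq hQ hQ1 hdQ
  have hsum : ∑ i, d i = 0 := by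
    simp only [hd, Pi.sub_apply, Finset.sum_sub_distrib, h.2.1, h'.2.1, sub_self]
  have hadd : ((fun i => |d i|) + d) ᵥ* Q = (fun i => |d i|) + d := by
    rw [Matrix.add_vecMul, habs, hdQ]
  have hsub : ((fun i => |d i|) - d) ᵥ* Q = (fun i => |d i|) - d := by
    rw [Matrix.sub_vecMul, habs, hdQ]
  have hadd0 : ∀ i, 0 ≤ ((fun i => |d i|) + d) i := fun i => by
    simp only [Pi.add_apply]; linarith [neg_abs_le (d i)]
  have hsub0 : ∀ i, 0 ≤ ((fun i => |d i|) - d) i := fun i => by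
    simp only [Pi.sub_apply]; linarith [le_abs_self (d i)]
  have hzero : ∀ i, |d i| = 0 := by
    by_cases hp : ∃ i, ((fun i => |d i|) + d) i ≠ 0
    · by_cases hm : ∃ i, ((fun i => |d i|) - d) i ≠ 0
      · obtain ⟨E, hE, hE'⟩ := exists_isErgodicClass_subset_support hQ hadd0 hadd hp
        obtain ⟨F, hF, hF'⟩ := exists_isErgodicClass_subset_support hQ hsub0 hsub hm
        -- On the common class both `|d| + d` and `|d| - d` would be positive, but one of them
        -- vanishes at each state.
        have hEF : E = F := hC.unique hE' hF'
        obtain ⟨i, hi⟩ := hE'.1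
        have h1 := hE i hi
        have h2 := hF i (hEF ▸ hi)
        simp only [Pi.add_apply, Pi.sub_apply] at h1 h2
        rcases abs_cases (d i) with hc | hc <;> linarith [hc.1]
      · push Not at hm
        -- Here `d` has constant sign and total zero, so it vanishes.
        have he : ∀ i, |d i| = d i := fun i => by
          have := hm i; simp only [Pi.sub_apply] at this; linarith
        have hs : ∑ i, |d i| = 0 := by simp only [he, hsum]
        exact fun i => (Finset.sum_eq_zero_iff_of_nonneg fun i _ => abs_nonneg (d i)).mp hs i
          (Finset.mem_univ i)
    · push Not at hp
      have he : ∀ i, |d i| = - d i := fun i => by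
        have := hp i; simp only [Pi.add_apply] at this; linarith
      have hs : ∑ i, |d i| = 0 := by simp only [he, Finset.sum_neg_distrib, hsum, neg_zero]
      exact fun i => (Finset.sum_eq_zero_iff_of_nonneg fun i _ => abs_nonneg (d i)).mp hs i
        (Finset.mem_univ i)
  funext i
  have := abs_eq_zero.mp (hzero i)
  simpa [hd, sub_eq_zero] using this

end MarkovChain

/-! ### Transition matrices of control rules -/

section Transition

variable {S A : Type*} [Fintype S] {M : MDP S A} {Ωp : Finset ℝ}

theorem ControlRule.transition_nonneg (m : ControlRule M) (s s' : S) : 0 ≤ m.transition s s' :=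
  Finset.sum_nonneg fun a ha => mul_nonneg (M.p_nonneg s a ha s') (m.nonneg s a)

theorem ControlRule.sum_transition (m : ControlRule M) (s : S) :
    ∑ s', m.transition s s' = 1 := by
  simp only [ControlRule.transition, Matrix.of_apply]
  rw [Finset.sum_comm, ← m.sum_eq_one s]
  exact Finset.sum_congr rfl fun a ha => by rw [← Finset.sum_mul, M.p_sum s a ha, one_mul]

theorem MDP.IsUnichain.stationary_unique [DecidableEq S] {n : ℕ} (hM : M.IsUnichain n)
    (hn : 0 < n) (m : ControlRule M) {π π' : S → ℝ}
    (h : IsStationaryDistribution m.transition π)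
    (h' : IsStationaryDistribution m.transition π') : π = π' := by
  have hC := (hM 1 le_rfl hn fun _ => m).2
  simp only [List.ofFn_succ, List.ofFn_zero, List.prod_cons, List.prod_nil, mul_one] at hC
  exact hC.stationary_unique m.transition_nonneg m.sum_transition h h'

/-- The stationary distributions of the joint chain of states and power levels are the products
of the stationary distributions of the state chain with the power rule. -/
theorem isStationaryDistribution_joint {m : ControlRule M} {w : PowerRule S Ωp} {x : S → ℝ}
    (hx : IsStationaryDistribution m.transition x) :
    IsStationaryDistribution (jointTransition m w) fun y => x y.1 * w.toFun y.1 y.2 := by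
  refine ⟨fun y => mul_nonneg (hx.1 _) (w.nonneg _ _), ?_, ?_⟩
  · rw [Fintype.sum_prod_type, ← hx.2.1]
    exact Finset.sum_congr rfl fun s _ => by simp only [← Finset.mul_sum, w.sum_eq_one, mul_one]
  · funext y
    have h := congrFun hx.2.2 y.1
    simp only [Matrix.vecMul, dotProduct, ControlRule.transition, Matrix.of_apply] at h
    simp only [Matrix.vecMul, dotProduct, jointTransition, Matrix.of_apply]
    rw [Fintype.sum_prod_type, ← h, Finset.sum_mul]
    refine Finset.sum_congr rfl fun s _ => ?_
    simp only [← Finset.sum_mul, ← Finset.mul_sum, w.sum_eq_one]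
    ring

/-- The next state ignores the present power level, and the next power level is drawn from `w` given
the next state alone. One step of the joint chain therefore produces a product form, which an
invariant distribution must already have. -/
theorem IsStationaryDistribution.of_joint {m : ControlRule M} {w : PowerRule S Ωp}
    {π : S × Ωp → ℝ} (h : IsStationaryDistribution (jointTransition m w) π) :
    IsStationaryDistribution m.transition (fun s => ∑ p, π (s, p)) ∧
      ∀ s p, π (s, p) = (∑ p', π (s, p')) * w.toFun s p := by
  have key : ∀ s p, π (s, p) =
      w.toFun s p * ((fun s => ∑ p, π (s, p)) ᵥ* m.transition) s := by
    intro s p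
    have h := congrFun h.2.2 (s, p)
    simp only [Matrix.vecMul, dotProduct, jointTransition, Matrix.of_apply] at h
    simp only [Matrix.vecMul, dotProduct, ControlRule.transition, Matrix.of_apply]
    rw [← h, Fintype.sum_prod_type, Finset.mul_sum]
    refine Finset.sum_congr rfl fun s' _ => ?_
    simp only [← Finset.sum_mul]
    ring
  have hinv : (fun s => ∑ p, π (s, p)) ᵥ* m.transition = fun s => ∑ p, π (s, p) := by
    funext s
    rw [Finset.sum_congr rfl fun p _ => key s p, ← Finset.sum_mul, w.sum_eq_one, one_mul]
  refine ⟨⟨fun s => Finset.sum_nonneg fun p _ => h.1 _, ?_, hinv⟩, fun s p => ?_⟩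
  · rw [← h.2.1, Fintype.sum_prod_type]
  · rw [key s p, hinv, mul_comm]

end Transition

/-! ### Occupation measures -/

section Occupation

variable {S A : Type*} [Fintype S] [DecidableEq S] [Fintype A] {M : MDP S A} {Ωp : Finset ℝ}

/-! ### Laws of the controlled process at a fixed time -/

omit [DecidableEq S] in
theorem ControlRule.sum_univ (m : ControlRule M) (s : S) : ∑ a, m.toFun s a = 1 := by
  rw [← m.sum_eq_one s]
  exact (Finset.sum_subset (Finset.subset_univ _) fun a _ ha => m.eq_zero s a ha).symm

/-- The probability that the state at time `k` is `s`. -/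
noncomputable def Policy.stateProb (μ : Policy M Ωp) (s0 : S) (k : ℕ) (s : S) : ℝ :=
  ∑ h : Fin k → S × A × Ωp, μ.pathProb s0 (List.ofFn h) s

omit [Fintype A] in
theorem Policy.pathProb_nonneg (μ : Policy M Ωp) (s0 : S) (h : List (S × A × Ωp)) (s : S) :
    0 ≤ μ.pathProb s0 h s := by
  induction h generalizing s with
  | nil => simp only [Policy.pathProb]; split_ifs <;> norm_num
  | cons x h ih =>
    obtain ⟨s', a, p⟩ := x
    simp only [Policy.pathProb]
    -- `M.p` is unconstrained, possibly negative, at unavailable actions; the control rule gives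
    -- these weight zero.
    by_cases ha : a ∈ M.act s'
    · exact mul_nonneg (mul_nonneg (mul_nonneg (ih s') ((μ.control h).nonneg _ _))
        ((μ.power h).nonneg _ _)) (M.p_nonneg s' a ha s)
    · simp [(μ.control h).eq_zero s' a ha]

theorem Policy.prob_nonneg (μ : Policy M Ωp) (s0 : S) (k : ℕ) (s : S) (a : A) (p : Ωp) :
    0 ≤ μ.prob s0 k s a p :=
  Finset.sum_nonneg fun _ _ => mul_nonneg (mul_nonneg (μ.pathProb_nonneg _ _ _)
    ((μ.control _).nonneg _ _)) ((μ.power _).nonneg _ _)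

theorem Policy.prob_eq_zero (μ : Policy M Ωp) (s0 : S) (k : ℕ) {s : S} {a : A}
    (ha : a ∉ M.act s) (p : Ωp) : μ.prob s0 k s a p = 0 :=
  Finset.sum_eq_zero fun h _ => by simp [(μ.control (List.ofFn h)).eq_zero s a ha]

theorem Policy.sum_prob (μ : Policy M Ωp) (s0 : S) (k : ℕ) (s : S) :
    ∑ a, ∑ p, μ.prob s0 k s a p = μ.stateProb s0 k s := by
  simp only [Policy.prob, Policy.stateProb]
  rw [Finset.sum_congr rfl fun a _ => Finset.sum_comm, Finset.sum_comm]
  refine Finset.sum_congr rfl fun h _ => ?_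
  simp only [← Finset.mul_sum, PowerRule.sum_eq_one, mul_one, ControlRule.sum_univ]

theorem Policy.stateProb_zero (μ : Policy M Ωp) (s0 s : S) :
    μ.stateProb s0 0 s = if s = s0 then 1 else 0 := by
  simp [Policy.stateProb, Policy.pathProb]

theorem Policy.stateProb_succ (μ : Policy M Ωp) (s0 : S) (k : ℕ) (s' : S) :
    μ.stateProb s0 (k + 1) s' = ∑ s, ∑ a, ∑ p, μ.prob s0 k s a p * M.p s a s' := by
  simp only [Policy.stateProb, Policy.prob, Finset.sum_mul]
  -- Coordinate 0 is the most recent entry of the past, so splitting it off is conditioning on the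
  -- last transition.
  rw [← (Fin.consEquiv fun _ : Fin (k + 1) => S × A × Ωp).sum_comp, Fintype.sum_prod_type,
    Fintype.sum_prod_type]
  refine Finset.sum_congr rfl fun s _ => ?_
  rw [Fintype.sum_prod_type]
  refine Finset.sum_congr rfl fun a _ => Finset.sum_congr rfl fun p _ =>
    Finset.sum_congr rfl fun h _ => ?_
  simp [Fin.consEquiv, List.ofFn_succ, Policy.pathProb]

theorem Policy.sum_stateProb (μ : Policy M Ωp) (s0 : S) (k : ℕ) :
    ∑ s, μ.stateProb s0 k s = 1 := by
  induction k with
  | zero => simp [Policy.stateProb_zero]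
  | succ k ih =>
    simp only [Policy.stateProb_succ]
    rw [Finset.sum_comm, ← ih]
    refine Finset.sum_congr rfl fun s _ => ?_
    rw [Finset.sum_comm, ← Policy.sum_prob]
    refine Finset.sum_congr rfl fun a _ => ?_
    rw [Finset.sum_comm]
    refine Finset.sum_congr rfl fun p _ => ?_
    rw [← Finset.mul_sum]
    by_cases ha : a ∈ M.act s
    · rw [M.p_sum s a ha, mul_one]
    · rw [μ.prob_eq_zero s0 k ha, zero_mul]

/-- The rules do not see the history and factor out of the sum over pasts. This product form is
linear in the state law, so it passes to averages and their limits. -/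
theorem Policy.stationary_prob (m : ControlRule M) (w : PowerRule S Ωp) (s0 : S) (k : ℕ)
    (s : S) (a : A) (p : Ωp) :
    (Policy.stationary m w).prob s0 k s a p =
      (∑ a', ∑ p', (Policy.stationary m w).prob s0 k s a' p') * (m.toFun s a * w.toFun s p) := by
  rw [Policy.sum_prob]
  simp only [Policy.prob, Policy.stateProb, Finset.sum_mul]
  exact Finset.sum_congr rfl fun h _ => by simp only [Policy.stationary]; ring

/-! ### Averaged occupation measures and their limits -/

/-- The average occupation measure of triples (state, action, power level) up to time `T`, with
the normalization of `Policy.timeAvg`. -/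
noncomputable def Policy.occ (μ : Policy M Ωp) (s0 : S) (T : ℕ) (x : S × A × Ωp) : ℝ :=
  (1 / (T : ℝ)) * ∑ k ∈ Finset.range (T + 1), μ.prob s0 k x.1 x.2.1 x.2.2

theorem Policy.timeAvg_eq_sum_occ (μ : Policy M Ωp) (s0 : S) (f : S → A → Ωp → ℝ) (T : ℕ) :
    μ.timeAvg s0 f T = ∑ s, ∑ a ∈ M.act s, ∑ p, μ.occ s0 T (s, a, p) * f s a p := by
  simp only [Policy.timeAvg, Policy.occ]
  rw [Finset.sum_comm, Finset.mul_sum]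
  refine Finset.sum_congr rfl fun s _ => ?_
  rw [Finset.sum_comm, Finset.mul_sum]
  refine Finset.sum_congr rfl fun a _ => ?_
  rw [Finset.sum_comm, Finset.mul_sum]
  refine Finset.sum_congr rfl fun p _ => ?_
  rw [mul_assoc, ← Finset.sum_mul]

theorem Policy.sum_occ (μ : Policy M Ωp) (s0 : S) (T : ℕ) (s : S) :
    ∑ a, ∑ p, μ.occ s0 T (s, a, p) =
      (1 / (T : ℝ)) * ∑ k ∈ Finset.range (T + 1), μ.stateProb s0 k s := by
  simp only [Policy.occ, ← Policy.sum_prob, ← Finset.mul_sum]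
  congr 1
  symm
  rw [Finset.sum_comm]
  exact Finset.sum_congr rfl fun a _ => Finset.sum_comm

theorem Policy.occ_nonneg (μ : Policy M Ωp) (s0 : S) (T : ℕ) (x : S × A × Ωp) :
    0 ≤ μ.occ s0 T x :=
  mul_nonneg (by positivity) (Finset.sum_nonneg fun _ _ => μ.prob_nonneg _ _ _ _ _)

theorem Policy.sum_sum_occ (μ : Policy M Ωp) (s0 : S) (T : ℕ) :
    ∑ s, ∑ a, ∑ p, μ.occ s0 T (s, a, p) = (1 / (T : ℝ)) * (T + 1) := by
  simp only [Policy.sum_occ, ← Finset.mul_sum]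
  rw [Finset.sum_comm]
  simp [Policy.sum_stateProb]

theorem Policy.occ_mem_Icc (μ : Policy M Ωp) (s0 : S) (T : ℕ) :
    μ.occ s0 T ∈ Set.Icc (0 : S × A × Ωp → ℝ) 2 := by
  refine ⟨fun x => μ.occ_nonneg s0 T x, fun x => ?_⟩
  have h1 : μ.occ s0 T x ≤ ∑ y, μ.occ s0 T y :=
    Finset.single_le_sum (fun y _ => μ.occ_nonneg s0 T y) (Finset.mem_univ x)
  have h2 : ∑ y, μ.occ s0 T y = (1 / (T : ℝ)) * (T + 1) := by
    rw [← μ.sum_sum_occ s0 T]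
    simp only [Fintype.sum_prod_type]
  -- There are `T + 1` terms divided by `T`, so the mass is at most 2 for `T ≥ 1`; at `T = 0` it is
  -- 0 by the convention `1 / 0 = 0`.
  have h3 : (1 / (T : ℝ)) * (T + 1) ≤ 2 := by
    rcases Nat.eq_zero_or_pos T with rfl | hT
    · simp
    · have : (1 : ℝ) ≤ T := by exact_mod_cast hT
      rw [one_div, inv_mul_le_iff₀ (by linarith)]
      linarith
  exact (h1.trans_eq h2).trans h3

/-- The flow balance of the occupation measures, up to a boundary term. -/
theorem Policy.occ_balance (μ : Policy M Ωp) (s0 : S) (T : ℕ) (s' : S) :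
    ∑ a, ∑ p, μ.occ s0 T (s', a, p) - ∑ s, ∑ a, ∑ p, μ.occ s0 T (s, a, p) * M.p s a s' =
      (1 / (T : ℝ)) * (μ.stateProb s0 0 s' - μ.stateProb s0 (T + 1) s') := by
  have h : ∑ s, ∑ a, ∑ p, μ.occ s0 T (s, a, p) * M.p s a s' =
      (1 / (T : ℝ)) * ∑ k ∈ Finset.range (T + 1), μ.stateProb s0 (k + 1) s' := by
    simp only [Policy.stateProb_succ, Policy.occ]
    symm
    rw [Finset.sum_comm, Finset.mul_sum]
    refine Finset.sum_congr rfl fun s _ => ?_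
    rw [Finset.sum_comm, Finset.mul_sum]
    refine Finset.sum_congr rfl fun a _ => ?_
    rw [Finset.sum_comm, Finset.mul_sum]
    refine Finset.sum_congr rfl fun p _ => ?_
    rw [mul_assoc, ← Finset.sum_mul]
  rw [h, Policy.sum_occ, ← mul_sub, ← Finset.sum_sub_distrib, Finset.sum_range_sub']

/-- A probability distribution on triples (state, action, power level) that is carried by the
available actions and satisfies the flow balance of the MDP. -/
structure IsBalanced (M : MDP S A) (Z : S × A × Ωp → ℝ) : Prop where
  nonneg : ∀ x, 0 ≤ Z x
  eq_zero : ∀ s a p, a ∉ M.act s → Z (s, a, p) = 0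
  sum_eq_one : ∑ s, ∑ a, ∑ p, Z (s, a, p) = 1
  balance : ∀ s', ∑ a, ∑ p, Z (s', a, p) = ∑ s, ∑ a, ∑ p, Z (s, a, p) * M.p s a s'

theorem Policy.stateProb_nonneg (μ : Policy M Ωp) (s0 : S) (k : ℕ) (s : S) :
    0 ≤ μ.stateProb s0 k s :=
  Finset.sum_nonneg fun _ _ => μ.pathProb_nonneg _ _ _

theorem Policy.stateProb_le_one (μ : Policy M Ωp) (s0 : S) (k : ℕ) (s : S) :
    μ.stateProb s0 k s ≤ 1 := by
  rw [← μ.sum_stateProb s0 k]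
  exact Finset.single_le_sum (fun y _ => μ.stateProb_nonneg s0 k y) (Finset.mem_univ s)

/-- Limits of occupation measures are balanced. -/
theorem Policy.isBalanced_of_tendsto (μ : Policy M Ωp) (s0 : S) {l : Filter ℕ} [l.NeBot]
    (hl : l ≤ atTop) {Z : S × A × Ωp → ℝ} (hZ : Tendsto (μ.occ s0) l (𝓝 Z)) :
    IsBalanced M Z := by
  have hpt : ∀ x, Tendsto (fun T => μ.occ s0 T x) l (𝓝 (Z x)) := tendsto_pi_nhds.mp hZ
  have hinv : Tendsto (fun T : ℕ => 1 / (T : ℝ)) l (𝓝 0) :=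
    tendsto_one_div_atTop_nhds_zero_nat.mono_left hl
  refine ⟨fun x => ge_of_tendsto' (hpt x) fun T => μ.occ_nonneg s0 T x, fun s a p ha => ?_, ?_,
    fun s' => ?_⟩
  · refine tendsto_nhds_unique (hpt (s, a, p)) (tendsto_const_nhds.congr fun T => ?_)
    simp [Policy.occ, μ.prob_eq_zero s0 _ ha]
  · have h1 : Tendsto (fun T => ∑ s, ∑ a, ∑ p, μ.occ s0 T (s, a, p)) l
        (𝓝 (∑ s, ∑ a, ∑ p, Z (s, a, p))) :=
      tendsto_finsetSum _ fun s _ => tendsto_finsetSum _ fun a _ =>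
        tendsto_finsetSum _ fun p _ => hpt _
    refine tendsto_nhds_unique h1 ?_
    have h2 : Tendsto (fun T : ℕ => 1 + 1 / (T : ℝ)) l (𝓝 (1 + 0)) := hinv.const_add 1
    rw [add_zero] at h2
    refine h2.congr' (((eventually_gt_atTop 0).filter_mono hl).mono fun T hT => ?_)
    have : (T : ℝ) ≠ 0 := by exact_mod_cast hT.ne'
    simp only [Policy.sum_sum_occ]
    field_simp
  · have h1 : Tendsto (fun T => ∑ a, ∑ p, μ.occ s0 T (s', a, p) -
        ∑ s, ∑ a, ∑ p, μ.occ s0 T (s, a, p) * M.p s a s') l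
        (𝓝 (∑ a, ∑ p, Z (s', a, p) - ∑ s, ∑ a, ∑ p, Z (s, a, p) * M.p s a s')) :=
      (tendsto_finsetSum _ fun a _ => tendsto_finsetSum _ fun p _ => hpt _).sub
        (tendsto_finsetSum _ fun s _ => tendsto_finsetSum _ fun a _ =>
          tendsto_finsetSum _ fun p _ => (hpt _).mul_const _)
    refine sub_eq_zero.mp (tendsto_nhds_unique h1 ?_)
    simp only [Policy.occ_balance]
    -- The boundary term is 1/T times a difference of two probabilities.
    refine squeeze_zero_norm (fun T => ?_) hinv
    rw [norm_mul, Real.norm_of_nonneg (by positivity : (0 : ℝ) ≤ 1 / (T : ℝ))]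
    refine mul_le_of_le_one_right (by positivity) ?_
    rw [Real.norm_eq_abs, abs_le]
    constructor <;> linarith [μ.stateProb_nonneg s0 0 s', μ.stateProb_nonneg s0 (T + 1) s',
      μ.stateProb_le_one s0 0 s', μ.stateProb_le_one s0 (T + 1) s']

theorem Policy.tendsto_timeAvg (μ : Policy M Ωp) (s0 : S) (f : S → A → Ωp → ℝ) {l : Filter ℕ}
    {Z : S × A × Ωp → ℝ} (hZ : Tendsto (μ.occ s0) l (𝓝 Z)) :
    Tendsto (μ.timeAvg s0 f) l (𝓝 (∑ s, ∑ a ∈ M.act s, ∑ p, Z (s, a, p) * f s a p)) := by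
  have hpt : ∀ x, Tendsto (fun T => μ.occ s0 T x) l (𝓝 (Z x)) := tendsto_pi_nhds.mp hZ
  simp only [funext (μ.timeAvg_eq_sum_occ s0 f)]
  exact tendsto_finsetSum _ fun s _ => tendsto_finsetSum _ fun a _ =>
    tendsto_finsetSum _ fun p _ => (hpt _).mul_const _

/-- Compactness of the box. A single ultrafilter makes the averages of cost and drop-out converge
simultaneously. -/
theorem Policy.exists_tendsto_occ (μ : Policy M Ωp) (s0 : S) :
    ∃ (U : Ultrafilter ℕ) (Z : S × A × Ωp → ℝ), (U : Filter ℕ) ≤ atTop ∧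
      Tendsto (μ.occ s0) U (𝓝 Z) := by
  obtain ⟨Z, -, hZ⟩ := (isCompact_Icc (a := (0 : S × A × Ωp → ℝ)) (b := 2)).exists_mapClusterPt
    (f := atTop) (u := μ.occ s0)
    (tendsto_principal.mpr (Eventually.of_forall (μ.occ_mem_Icc s0)))
  obtain ⟨U, hU, h⟩ := mapClusterPt_iff_ultrafilter.mp hZ
  exact ⟨U, Z, hU, h⟩

/-- Boundedness makes the real-valued `limsup` meaningful and allows its comparison along finer
filters. -/
theorem Policy.timeAvg_bounded (μ : Policy M Ωp) (s0 : S) (f : S → A → Ωp → ℝ) :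
    ∃ B, ∀ T, |μ.timeAvg s0 f T| ≤ B := by
  refine ⟨∑ s, ∑ a ∈ M.act s, ∑ p, 2 * |f s a p|, fun T => ?_⟩
  rw [Policy.timeAvg_eq_sum_occ]
  refine (Finset.abs_sum_le_sum_abs _ _).trans (Finset.sum_le_sum fun s _ => ?_)
  refine (Finset.abs_sum_le_sum_abs _ _).trans (Finset.sum_le_sum fun a _ => ?_)
  refine (Finset.abs_sum_le_sum_abs _ _).trans (Finset.sum_le_sum fun p _ => ?_)
  rw [abs_mul, abs_of_nonneg (μ.occ_nonneg s0 T _)]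
  exact mul_le_mul_of_nonneg_right ((μ.occ_mem_Icc s0 T).2 _) (abs_nonneg _)

/-- A limit of the time averages along a finer filter is at most their limit superior. -/
theorem Policy.le_limsup_timeAvg (μ : Policy M Ωp) (s0 : S) (f : S → A → Ωp → ℝ)
    {l : Filter ℕ} [l.NeBot] (hl : l ≤ atTop) {c : ℝ}
    (hc : Tendsto (μ.timeAvg s0 f) l (𝓝 c)) : c ≤ limsup (μ.timeAvg s0 f) atTop := by
  obtain ⟨B, hB⟩ := μ.timeAvg_bounded s0 f
  rw [← hc.limsup_eq]
  refine limsup_le_limsup_of_le hl ?_ ?_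
  · exact hc.isCoboundedUnder_le
  · exact isBoundedUnder_of ⟨B, fun T => (abs_le.mp (hB T)).2⟩

/-- Any limit along an ultrafilter keeps the product form with the two rules, and balance then says
that its state marginal is invariant. Uniqueness leaves a single cluster point, and in a compact set
this forces convergence. -/
theorem Policy.stationary_tendsto_occ {n : ℕ} (hM : M.IsUnichain n) (hn : 0 < n)
    (m : ControlRule M) (w : PowerRule S Ωp) (s0 : S) :
    ∃ x : S → ℝ, IsStationaryDistribution m.transition x ∧
      Tendsto ((Policy.stationary m w).occ s0) atTop
        (𝓝 fun y => x y.1 * (m.toFun y.1 y.2.1 * w.toFun y.1 y.2.2)) := by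
  set μ : Policy M Ωp := Policy.stationary m w with hμ
  have key : ∀ (U : Ultrafilter ℕ) (Z : S × A × Ωp → ℝ), (U : Filter ℕ) ≤ atTop →
      Tendsto (μ.occ s0) U (𝓝 Z) → ∃ x : S → ℝ, IsStationaryDistribution m.transition x ∧
        Z = fun y => x y.1 * (m.toFun y.1 y.2.1 * w.toFun y.1 y.2.2) := by
    intro U Z hU hZ
    have hb := μ.isBalanced_of_tendsto s0 hU hZ
    have hpt : ∀ x, Tendsto (fun T => μ.occ s0 T x) U (𝓝 (Z x)) := tendsto_pi_nhds.mp hZ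
    have hprod : ∀ s a p, Z (s, a, p) =
        (∑ a', ∑ p', Z (s, a', p')) * (m.toFun s a * w.toFun s p) := by
      intro s a p
      refine tendsto_nhds_unique (hpt (s, a, p)) ?_
      have h1 : Tendsto (fun T => (∑ a', ∑ p', μ.occ s0 T (s, a', p')) *
          (m.toFun s a * w.toFun s p)) U
          (𝓝 ((∑ a', ∑ p', Z (s, a', p')) * (m.toFun s a * w.toFun s p))) :=
        (tendsto_finsetSum _ fun a _ => tendsto_finsetSum _ fun p _ => hpt _).mul_const _
      refine h1.congr fun T => ?_
      rw [Policy.sum_occ, Policy.occ, mul_assoc, Finset.sum_mul]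
      congr 1
      refine Finset.sum_congr rfl fun k _ => ?_
      change _ = μ.prob s0 k s a p
      rw [hμ, Policy.stationary_prob, Policy.sum_prob]
    refine ⟨fun s => ∑ a, ∑ p, Z (s, a, p),
      ⟨fun s => Finset.sum_nonneg fun a _ => Finset.sum_nonneg fun p _ => hb.nonneg _,
        hb.sum_eq_one, ?_⟩, ?_⟩
    · funext s'
      rw [hb.balance s']
      simp only [Matrix.vecMul, dotProduct, ControlRule.transition, Matrix.of_apply]
      refine Finset.sum_congr rfl fun s _ => ?_
      have hs : ∀ a, ∑ p, Z (s, a, p) * M.p s a s' =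
          (∑ a', ∑ p', Z (s, a', p')) * (M.p s a s' * m.toFun s a) := by
        intro a
        rw [Finset.sum_congr rfl fun p _ => by rw [hprod s a p]]
        rw [← Finset.sum_mul, ← Finset.mul_sum, ← Finset.mul_sum, w.sum_eq_one]
        ring
      rw [Finset.sum_congr rfl fun a _ => hs a, ← Finset.mul_sum]
      congr 1
      exact Finset.sum_subset (Finset.subset_univ _) fun a _ ha => by
        rw [m.eq_zero s a ha, mul_zero]
    · funext ⟨s, a, p⟩
      exact hprod s a p
  obtain ⟨U, Z, hU, hZ⟩ := μ.exists_tendsto_occ s0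
  obtain ⟨x, hx, -⟩ := key U Z hU hZ
  refine ⟨x, hx, ?_⟩
  refine (isCompact_Icc (a := (0 : S × A × Ωp → ℝ)) (b := 2)).tendsto_nhds_of_unique_mapClusterPt
    (Eventually.of_forall (μ.occ_mem_Icc s0)) fun Z' _ hZ' => ?_
  obtain ⟨V, hV, h⟩ := mapClusterPt_iff_ultrafilter.mp hZ'
  obtain ⟨x', hx', rfl⟩ := key V Z' hV h
  rw [hM.stationary_unique hn m hx hx']

end Occupation

/-! ### Occupation measures and the linear program -/

namespace CoDesign

variable {S A : Type*} [Fintype S] {Ωp : Finset ℝ}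

section

variable [DecidableEq S] [Fintype A]

omit [DecidableEq S] in
-- The cost is a function of (s, a) plus a function of (s, p), so any correlation between action and
-- power level in `Z` is irrelevant.
theorem sum_runningCost_eq_lpValue (D : CoDesign S A Ωp) {Z : S × A × Ωp → ℝ}
    (hZ : IsBalanced D.mdp Z) :
    ∑ s, ∑ a ∈ D.mdp.act s, ∑ p, Z (s, a, p) * D.runningCost s a p =
      D.lpValue (fun s a => ∑ p, Z (s, a, p)) fun s p => ∑ a, Z (s, a, p) := by
  simp only [runningCost, lpValue, mul_add, Finset.sum_add_distrib, Finset.sum_mul]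
  congr 1
  rw [Finset.mul_sum]
  refine Finset.sum_congr rfl fun s _ => ?_
  rw [Finset.sum_comm, Finset.mul_sum]
  refine Finset.sum_congr rfl fun p _ => ?_
  rw [Finset.mul_sum, Finset.sum_subset (Finset.subset_univ (D.mdp.act s)) fun a _ ha => by
    rw [hZ.eq_zero s a p ha, zero_mul]]
  exact Finset.sum_congr rfl fun a _ => by ring

omit [DecidableEq S] in
theorem sum_drop_eq (D : CoDesign S A Ωp) {Z : S × A × Ωp → ℝ} (hZ : IsBalanced D.mdp Z) :
    ∑ s, ∑ a ∈ D.mdp.act s, ∑ p, Z (s, a, p) * D.channel.θ s p =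
      ∑ s, ∑ p, D.channel.θ s p * ∑ a, Z (s, a, p) := by
  refine Finset.sum_congr rfl fun s _ => ?_
  rw [Finset.sum_comm]
  refine Finset.sum_congr rfl fun p _ => ?_
  rw [Finset.sum_subset (Finset.subset_univ (D.mdp.act s)) fun a _ ha => by
    rw [hZ.eq_zero s a p ha, zero_mul], Finset.mul_sum]
  exact Finset.sum_congr rfl fun a _ => mul_comm _ _

omit [DecidableEq S] in
-- The constraint coupling `X₁` and `X₂` holds because both are marginals of one measure and share
-- its state marginal.
theorem lpFeasible_of_isBalanced (D : CoDesign S A Ωp) {Z : S × A × Ωp → ℝ}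
    (hZ : IsBalanced D.mdp Z)
    (hθ : ∑ s, ∑ a ∈ D.mdp.act s, ∑ p, Z (s, a, p) * D.channel.θ s p < D.threshold) :
    D.LPFeasible (fun s a => ∑ p, Z (s, a, p)) fun s p => ∑ a, Z (s, a, p) := by
  have hact : ∀ s, ∑ a ∈ D.mdp.act s, ∑ p, Z (s, a, p) = ∑ a, ∑ p, Z (s, a, p) := fun s =>
    Finset.sum_subset (Finset.subset_univ _) fun a _ ha =>
      Finset.sum_eq_zero fun p _ => hZ.eq_zero s a p ha
  refine ⟨fun s a _ => Finset.sum_nonneg fun p _ => hZ.nonneg _,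
    fun s p => Finset.sum_nonneg fun a _ => hZ.nonneg _, fun s' => ?_, ?_, ?_, fun s => ?_, ?_⟩
  · rw [hact, hZ.balance, sub_eq_zero]
    refine Finset.sum_congr rfl fun s _ => ?_
    rw [Finset.sum_subset (Finset.subset_univ (D.mdp.act s)) fun a _ ha => by
      rw [Finset.sum_eq_zero fun p _ => hZ.eq_zero s a p ha, mul_zero]]
    exact Finset.sum_congr rfl fun a _ => by rw [← Finset.sum_mul, mul_comm]
  · simp only [hact, hZ.sum_eq_one]
  · rw [← hZ.sum_eq_one]
    exact Finset.sum_congr rfl fun s _ => Finset.sum_comm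
  · rw [hact, Finset.sum_comm]
  · rw [← sum_drop_eq D hZ]
    exact hθ

/-- The average cost of a safe policy is at least the value of some feasible point of the linear
program. -/
theorem exists_lpFeasible_le_J (D : CoDesign S A Ωp) {s0 : S} {μ : Policy D.mdp Ωp}
    (hμ : D.Safe s0 μ) : ∃ X₁ X₂, D.LPFeasible X₁ X₂ ∧ D.lpValue X₁ X₂ ≤ D.J s0 μ := by
  obtain ⟨U, Z, hU, hZ⟩ := μ.exists_tendsto_occ s0
  have hb := μ.isBalanced_of_tendsto s0 hU hZ
  refine ⟨_, _, D.lpFeasible_of_isBalanced hb ?_, ?_⟩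
  · exact (μ.le_limsup_timeAvg s0 _ hU (μ.tendsto_timeAvg s0 _ hZ)).trans_lt hμ
  · rw [← D.sum_runningCost_eq_lpValue hb]
    exact μ.le_limsup_timeAvg s0 _ hU (μ.tendsto_timeAvg s0 _ hZ)

/-- Under a stationary policy the time averages converge to the values at the product of the
stationary distribution with the decision rules. -/
theorem stationary_tendsto (D : CoDesign S A Ωp) {n : ℕ} (hn : 0 < n)
    (hM : D.mdp.IsUnichain n) (s0 : S) (m : ControlRule D.mdp) (w : PowerRule S Ωp) {x : S → ℝ}
    (hx : IsStationaryDistribution m.transition x) :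
    Tendsto ((Policy.stationary m w).timeAvg s0 D.runningCost) atTop
      (𝓝 (D.lpValue (fun s a => x s * m.toFun s a) fun s p => x s * w.toFun s p)) ∧
    Tendsto ((Policy.stationary m w).timeAvg s0 fun s _ p => D.channel.θ s p) atTop
      (𝓝 (∑ s, ∑ p, D.channel.θ s p * (x s * w.toFun s p))) ∧
    (D.Safe s0 (Policy.stationary m w) →
      D.LPFeasible (fun s a => x s * m.toFun s a) fun s p => x s * w.toFun s p) := by
  obtain ⟨x', hx', hZ⟩ := Policy.stationary_tendsto_occ hM hn m w s0
  -- The limit comes with some stationary distribution; uniqueness identifies it with the given one.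
  obtain rfl := hM.stationary_unique hn m hx hx'
  have hb := Policy.isBalanced_of_tendsto _ s0 le_rfl hZ
  have hX₁ : (fun s a => ∑ p, x s * (m.toFun s a * w.toFun s p)) =
      fun s a => x s * m.toFun s a := by
    funext s a
    rw [← Finset.mul_sum, ← Finset.mul_sum, w.sum_eq_one, mul_one]
  have hX₂ : (fun s p => ∑ a, x s * (m.toFun s a * w.toFun s p)) =
      fun s p => x s * w.toFun s p := by
    funext s p
    rw [← Finset.mul_sum, ← Finset.sum_mul, m.sum_univ, one_mul]
  have h1 := Policy.tendsto_timeAvg _ s0 D.runningCost hZ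
  have h2 := Policy.tendsto_timeAvg _ s0 (fun s _ p => D.channel.θ s p) hZ
  have h3 := D.lpFeasible_of_isBalanced hb
  rw [D.sum_runningCost_eq_lpValue hb] at h1
  simp only [hX₁, hX₂] at h1 h3
  refine ⟨h1, ?_, fun hs => h3 ?_⟩
  · rw [D.sum_drop_eq hb] at h2
    simpa only [fun s p => congrFun (congrFun hX₂ s) p] using h2
  · rw [Safe, h2.limsup_eq] at hs
    exact hs

end

/-! ### From feasible points to stationary policies -/

/-- The control rule and the power rule obtained by normalizing a feasible point. -/
theorem LPFeasible.exists_isNormalization {D : CoDesign S A Ωp} {X₁ : S → A → ℝ}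
    {X₂ : S → Ωp → ℝ} (hX : D.LPFeasible X₁ X₂) :
    ∃ (m : ControlRule D.mdp) (w : PowerRule S Ωp), D.IsNormalization X₁ X₂ m w := by
  classical
  -- `X₂` has total mass 1, so some power level exists; a point mass there serves as the default
  -- rule at states of zero mass.
  have hne : Nonempty Ωp := by
    by_contra h
    rw [not_nonempty_iff] at h
    have := hX.sum₂
    simp at this
  obtain ⟨p0⟩ := hne
  choose a0 ha0 using D.mdp.act_nonempty
  refine ⟨⟨fun s a => if a ∈ D.mdp.act s then
      if ∑ a' ∈ D.mdp.act s, X₁ s a' = 0 then if a = a0 s then 1 else 0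
      else X₁ s a / ∑ a' ∈ D.mdp.act s, X₁ s a' else 0, ?_, ?_, ?_⟩,
    ⟨fun s p => if ∑ p', X₂ s p' = 0 then if p = p0 then 1 else 0
      else X₂ s p / ∑ p', X₂ s p', ?_, ?_⟩, ?_, ?_⟩
  · intro s a
    split_ifs with h1 h2 h3
    · exact zero_le_one
    · exact le_rfl
    · exact div_nonneg (hX.nonneg₁ s a h1) (Finset.sum_nonneg (hX.nonneg₁ s))
    · exact le_rfl
  · intro s a ha
    simp [ha]
  · intro s
    rw [Finset.sum_congr rfl fun a ha => if_pos ha]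
    by_cases h : ∑ a' ∈ D.mdp.act s, X₁ s a' = 0
    · simp only [h, if_true, Finset.sum_ite_eq', ha0 s]
    · simp only [h, if_false, ← Finset.sum_div, div_self h]
  · intro s p
    split_ifs
    · exact zero_le_one
    · exact le_rfl
    · exact div_nonneg (hX.nonneg₂ s p) (Finset.sum_nonneg fun p _ => hX.nonneg₂ s p)
  · intro s
    by_cases h : ∑ p', X₂ s p' = 0
    · simp only [h, if_true, Finset.sum_ite_eq', Finset.mem_univ]
    · simp only [h, if_false, ← Finset.sum_div, div_self h]
  · intro s hs a ha
    simp [ha, hs]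
  · intro s hs p
    exact if_neg hs

/-- A feasible point is the product of a stationary distribution with its normalization. -/
theorem LPFeasible.eq_of_isNormalization {D : CoDesign S A Ωp} {X₁ : S → A → ℝ}
    {X₂ : S → Ωp → ℝ} (hX : D.LPFeasible X₁ X₂) {m : ControlRule D.mdp} {w : PowerRule S Ωp}
    (hN : D.IsNormalization X₁ X₂ m w) :
    IsStationaryDistribution m.transition (fun s => ∑ a ∈ D.mdp.act s, X₁ s a) ∧
    (∀ s, ∀ a ∈ D.mdp.act s, X₁ s a = (∑ a' ∈ D.mdp.act s, X₁ s a') * m.toFun s a) ∧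
    ∀ s p, X₂ s p = (∑ a' ∈ D.mdp.act s, X₁ s a') * w.toFun s p := by
  have h1 : ∀ s, ∀ a ∈ D.mdp.act s, X₁ s a = (∑ a' ∈ D.mdp.act s, X₁ s a') * m.toFun s a := by
    intro s a ha
    by_cases h : ∑ a' ∈ D.mdp.act s, X₁ s a' = 0
    -- At a state of zero mass the nonnegative entries all vanish, so the identity holds whatever
    -- the rule is there.
    · rw [h, zero_mul]
      exact (Finset.sum_eq_zero_iff_of_nonneg (hX.nonneg₁ s)).mp h a ha
    · rw [hN.1 s h a ha, mul_div_cancel₀ _ h]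
  have h2 : ∀ s p, X₂ s p = (∑ a' ∈ D.mdp.act s, X₁ s a') * w.toFun s p := by
    intro s p
    rw [hX.marginal s]
    by_cases h : ∑ p', X₂ s p' = 0
    · rw [h, zero_mul]
      exact (Finset.sum_eq_zero_iff_of_nonneg fun p _ => hX.nonneg₂ s p).mp h p
        (Finset.mem_univ p)
    · rw [hN.2 s h p, mul_div_cancel₀ _ h]
  refine ⟨⟨fun s => Finset.sum_nonneg (hX.nonneg₁ s), hX.sum₁, ?_⟩, h1, h2⟩
  funext s'
  rw [sub_eq_zero.mp (hX.balance s')]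
  simp only [Matrix.vecMul, dotProduct, ControlRule.transition, Matrix.of_apply]
  refine Finset.sum_congr rfl fun s _ => ?_
  rw [Finset.mul_sum]
  refine Finset.sum_congr rfl fun a ha => ?_
  rw [h1 s a ha]
  ring

/-- Agreement is required only at available actions, since feasibility does not control `X₁`
elsewhere. -/
theorem lpValue_congr (D : CoDesign S A Ωp) {X₁ Y₁ : S → A → ℝ} {X₂ Y₂ : S → Ωp → ℝ}
    (h₁ : ∀ s, ∀ a ∈ D.mdp.act s, X₁ s a = Y₁ s a) (h₂ : ∀ s p, X₂ s p = Y₂ s p) :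
    D.lpValue X₁ X₂ = D.lpValue Y₁ Y₂ := by
  simp only [lpValue, h₂]
  congr 1
  exact Finset.sum_congr rfl fun s _ => Finset.sum_congr rfl fun a ha => by rw [h₁ s a ha]

/-- The normalization of a feasible point is a safe policy whose average cost is the value of
the objective. -/
theorem LPFeasible.stationary_safe [DecidableEq S] [Fintype A] {D : CoDesign S A Ωp}
    {X₁ : S → A → ℝ} {X₂ : S → Ωp → ℝ} (hX : D.LPFeasible X₁ X₂) {n : ℕ} (hn : 0 < n)
    (hM : D.mdp.IsUnichain n) (s0 : S) {m : ControlRule D.mdp} {w : PowerRule S Ωp}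
    (hN : D.IsNormalization X₁ X₂ m w) :
    D.Safe s0 (Policy.stationary m w) ∧
    Tendsto ((Policy.stationary m w).timeAvg s0 D.runningCost) atTop (𝓝 (D.lpValue X₁ X₂)) := by
  obtain ⟨hx, h1, h2⟩ := hX.eq_of_isNormalization hN
  obtain ⟨hJ, hθ, -⟩ := D.stationary_tendsto hn hM s0 m w hx
  constructor
  · rw [Safe, hθ.limsup_eq]
    simp only [← h2]
    exact hX.safety
  · rwa [D.lpValue_congr h1 h2]

end CoDesign

/-! ### Equivalence of the co-design problem and the linear program -/

theorem mainTheorem4 {S A : Type*} [Fintype S] [DecidableEq S] [Fintype A] {Ωp : Finset ℝ}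
    (D : CoDesign S A Ωp) (n : ℕ) (hn : 0 < n) (hM : D.mdp.IsUnichain n) (s0 : S) :
    (∀ (X₁ : S → A → ℝ) (X₂ : S → Ωp → ℝ), D.IsLPOptimal X₁ X₂ →
      (∃ (m : ControlRule D.mdp) (w : PowerRule S Ωp), D.IsNormalization X₁ X₂ m w) ∧
      ∀ (m : ControlRule D.mdp) (w : PowerRule S Ωp), D.IsNormalization X₁ X₂ m w →
        D.IsOptimalPolicy s0 (Policy.stationary m w) ∧
        Tendsto ((Policy.stationary m w).timeAvg s0 D.runningCost) atTop
          (𝓝 (D.lpValue X₁ X₂)) ∧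
        ∃ π : S × Ωp → ℝ, IsStationaryDistribution (jointTransition m w) π ∧
          (∀ π', IsStationaryDistribution (jointTransition m w) π' → π' = π) ∧
          (∀ s p, π (s, p) = X₂ s p) ∧
          ∑ x, D.channel.θ x.1 x.2 * π x < D.threshold) ∧
    (∀ (m : ControlRule D.mdp) (w : PowerRule S Ωp),
      D.IsOptimalPolicy s0 (Policy.stationary m w) →
      ∃ (X₁ : S → A → ℝ) (X₂ : S → Ωp → ℝ),
        D.IsLPOptimal X₁ X₂ ∧ D.IsNormalization X₁ X₂ m w) := by
  refine ⟨fun X₁ X₂ hX => ⟨hX.1.exists_isNormalization, fun m w hN => ?_⟩, fun m w hopt => ?_⟩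
  · obtain ⟨hsafe, hJ⟩ := hX.1.stationary_safe hn hM s0 hN
    obtain ⟨hx, -, h2⟩ := hX.1.eq_of_isNormalization hN
    refine ⟨⟨hsafe, fun ν hν => ?_⟩, hJ, _, isStationaryDistribution_joint hx, fun π' hπ' => ?_,
      fun s p => (h2 s p).symm, ?_⟩
    -- A safe competitor, however history-dependent, costs at least the value of some feasible
    -- point, hence at least the optimum.
    · obtain ⟨Y₁, Y₂, hY, hle⟩ := D.exists_lpFeasible_le_J hν
      rw [CoDesign.J, hJ.limsup_eq]
      exact (hX.2 Y₁ Y₂ hY).trans hle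
    · obtain ⟨hσ, hprod⟩ := hπ'.of_joint
      funext ⟨s, p⟩
      rw [hprod s p, congrFun (hM.stationary_unique hn m hσ hx) s]
    · rw [Fintype.sum_prod_type]
      simp only [← h2]
      exact hX.1.safety
  · obtain ⟨x, hx, -⟩ := Policy.stationary_tendsto_occ hM hn m w s0
    obtain ⟨hJ, -, hfeas⟩ := D.stationary_tendsto hn hM s0 m w hx
    refine ⟨fun s a => x s * m.toFun s a, fun s p => x s * w.toFun s p,
      ⟨hfeas hopt.1, fun Y₁ Y₂ hY => ?_⟩, fun s hs a _ => ?_, fun s hs p => ?_⟩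
    -- A competing feasible point is realized by a safe stationary policy of the same value, which
    -- cannot beat the optimal one.
    · obtain ⟨m', w', hN⟩ := hY.exists_isNormalization
      obtain ⟨hsafe, hJ'⟩ := hY.stationary_safe hn hM s0 hN
      have h := hopt.2 _ hsafe
      rwa [CoDesign.J, CoDesign.J, hJ.limsup_eq, hJ'.limsup_eq] at h
    -- The denominator is `x s`, which cancels where it is nonzero.
    · simp only [← Finset.mul_sum, m.sum_eq_one, mul_one] at hs ⊢
      rw [mul_div_cancel_left₀ _ hs]
    · simp only [← Finset.mul_sum, w.sum_eq_one, mul_one] at hs ⊢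
      rw [mul_div_cancel_left₀ _ hs]
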